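/- Let $k$ be a field, $n\ge 3$ an integer, $\mathcal T$ a $k$-linear triangulated category with shift functor $\Sigma$, $\mathcal T^{fd}\subseteq\mathcal T$ a (full) triangulated subcategory, and $M\in\mathcal T$ an object. Let $\mathcal M=\mathrm{add}(M)$ be the full subcategory of direct summands of finite direct sums of copies of $M$. Assume that $(\mathcal T,\mathcal T^{fd},\mathcal M)$ is an $n$-Calabi–Yau triple, that is: (CY1) $\mathcal T$ is Hom-finite over $k$ and Krull–Schmidt; (CY2) there is an isomorphism $D\,\mathcal T(X,Y)\cong\mathcal T(Y,\Sigma^nX)$, bifunctorial in $X\in\mathcal T^{fd}$ and $Y\in\mathcal T$, where $D=\mathrm{Hom}_k(-,k)$; (CY3) $\mathcal M$ is silting, i.e. $\mathcal T(\mathcal M,\Sigma^i\mathcal M)=0$ for all $i>0$ and $\mathcal T$ is the smallest triangulated subcategory of $\mathcal T$ that is closed under direct summands and contains $\mathcal M$; and $(\mathcal T^{\le 0},\mathcal T^{\ge 0})=((\Sigma^{<0}\mathcal M)^{\perp},(\Sigma^{>0}\mathcal M)^{\perp})$ is a $t$-structure on $\mathcal T$ with $\mathcal T^{\ge 0}\subseteq\mathcal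 T^{fd}$, where $\mathcal B^\perp=\{A\in\mathcal T\mid \mathcal T(\mathcal B,A)=0\}$. For $X\in\mathcal T$ and $m\in\mathbb Z$ let $X^{\le m}\xrightarrow{f_X^m}X\to X^{\ge m+1}\to\Sigma X^{\le m}$ be the truncation triangle for this $t$-structure, and let $Q:\mathcal T\to\mathcal T/\mathcal T^{fd}$ be the Verdier quotient functor. Let $X,Y\in\mathcal T$. (a) The direct system of $k$-vector spaces $$\mathcal T(X,Y)\to\mathcal T(X^{\le 0},Y)\to\mathcal T(X^{\le -1},Y)\to\mathcal T(X^{\le -2},Y)\to\cdots$$ induced by the canonical morphisms $X^{\le -p-1}\to X^{\le -p}$ and $X^{\le 0}\to X$ stabilizes: all of its transition maps from some index on are isomorphisms. Moreover there is a $k$-linear isomorphism $$\varinjlim_{p\ge 0}\mathcal T(X^{\le -p},Y)\;\cong\;\mathcal T/\mathcal T^{fd}(X,Y)$$ which sends the class of $g\in\mathcal T(X^{\le -p},Y)$ to $Q(g)\circ Q(f_X^{-p})^{-1}$. (b) There is a $k$-linear isomorphism $$\mathcal T/\mathcal T^{fd}(X,Y)\;\cong\;\varprojlim_{q\ge 0}\Big(\varinjlim_{p\ge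 0}\mathcal T(\Sigma^{-1}X^{\ge -p+1},Y^{\le -q})\Big),$$ where the systems are induced by the canonical morphisms between truncations. It is induced by the first morphisms $\delta_p$ of the rotated truncation triangles $\Sigma^{-1}X^{\ge -p+1}\xrightarrow{\delta_p}X^{\le -p}\to X\to X^{\ge -p+1}$: whenever $\varphi\in\mathcal T/\mathcal T^{fd}(X,Y)$ and $g\in\mathcal T(X^{\le -p},Y^{\le -q})$ satisfy $\varphi\circ Q(f_X^{-p})=Q(f_Y^{-q}\circ g)$, the $q$-th component of the image of $\varphi$ is the class of $g\circ\delta_p$. -/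

import Mathlib

open CategoryTheory Category Limits Pretriangulated Triangulated Opposite

universe w v u

noncomputable section

namespace CYTriple

section General

variable {T : Type u} [Category.{v} T] [Preadditive T] [HasZeroObject T] [HasShift T ℤ]
  [∀ m : ℤ, (shiftFunctor T m).Additive] [Pretriangulated T]

/-- `add M`: the full subcategory of direct summands of finite direct sums of copies of `M`. -/
def add (M : T) : ObjectProperty T := fun X =>
  ∃ m : ℕ, Nonempty (Retract X (⨁ fun _ : Fin m => M))

/-- `Σ^{<m} 𝓜`: the objects `Σ^i P` with `P ∈ 𝓜` and `i < m` (up to isomorphism). -/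
def shiftsLT (𝓜 : ObjectProperty T) (m : ℤ) : ObjectProperty T := fun Z =>
  ∃ (P : T) (i : ℤ), 𝓜 P ∧ i < m ∧ Nonempty (Z ≅ P⟦i⟧)

/-- `Σ^{>m} 𝓜`: the objects `Σ^i P` with `P ∈ 𝓜` and `i > m` (up to isomorphism). -/
def shiftsGT (𝓜 : ObjectProperty T) (m : ℤ) : ObjectProperty T := fun Z =>
  ∃ (P : T) (i : ℤ), 𝓜 P ∧ m < i ∧ Nonempty (Z ≅ P⟦i⟧)

/-- A silting subcategory: `Hom(𝓜, Σ^i 𝓜) = 0` for all `i > 0`, and `thick(𝓜)` is the whole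
category. -/
structure IsSilting (𝓜 : ObjectProperty T) : Prop where
  presilting : ∀ ⦃P Q : T⦄, 𝓜 P → 𝓜 Q → ∀ i : ℤ, 0 < i → ∀ f : P ⟶ Q⟦i⟧, f = 0
  thick_eq_top : 𝓜.triangEnvelope = ⊤

/-- `t` is the t-structure right adjacent to `𝓜`:
`(T^{≤ 0}, T^{≥ 0}) = ((Σ^{<0} 𝓜)^⊥, (Σ^{>0} 𝓜)^⊥)`. -/
structure IsRightAdjacent (𝓜 : ObjectProperty T) (t : TStructure T) : Prop where
  le_zero : t.le 0 = (shiftsLT 𝓜 0).rightOrthogonal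
  ge_zero : t.ge 0 = (shiftsGT 𝓜 0).rightOrthogonal

variable (T) in
/-- Every object is a finite direct sum of objects with local endomorphism rings. -/
def IsKrullSchmidt : Prop :=
  ∀ X : T, ∃ (m : ℕ) (F : Fin m → T),
    (∀ i, IsLocalRing (End (F i))) ∧ Nonempty (X ≅ ⨁ F)

variable (k : Type w) [Field k] [Linear k T]

/-- A bifunctorial `k`-linear isomorphism `D Hom(X, Y) ≅ Hom(Y, Σ^n X)` for `X ∈ Tfd` and
`Y ∈ T`, where `D = Hom_k(-, k)`. -/
structure RelativeCYDuality (n : ℕ) (Tfd : ObjectProperty T) where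
  iso (X Y : T) (hX : Tfd X) : Module.Dual k (X ⟶ Y) ≃ₗ[k] (Y ⟶ X⟦(n : ℤ)⟧)
  naturality_left {X X' : T} (hX : Tfd X) (hX' : Tfd X') (f : X ⟶ X') (Y : T)
    (φ : Module.Dual k (X ⟶ Y)) :
    iso X' Y hX' (φ ∘ₗ Linear.leftComp k Y f) = iso X Y hX φ ≫ f⟦(n : ℤ)⟧'
  naturality_right {X : T} (hX : Tfd X) {Y Y' : T} (g : Y ⟶ Y')
    (φ : Module.Dual k (X ⟶ Y')) :
    iso X Y hX (φ ∘ₗ Linear.rightComp k X g) = g ≫ iso X Y' hX φ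

/-- `(T, Tfd, 𝓜)` is an `n`-Calabi-Yau triple. (The requirements that `3 ≤ n`, that `T` is a
`k`-linear triangulated category and that `Tfd` is a triangulated subcategory are carried by the
context in which this predicate is used.) -/
structure IsCYTriple (n : ℕ) (Tfd 𝓜 : ObjectProperty T) : Prop where
  additive : 𝓜.IsClosedUnderFiniteProducts
  homFinite : ∀ X Y : T, Module.Finite k (X ⟶ Y)
  krullSchmidt : IsKrullSchmidt T
  relativeCY : Nonempty (RelativeCYDuality k n Tfd)
  silting : IsSilting 𝓜
  exists_tStructure : ∃ t : TStructure T, IsRightAdjacent 𝓜 t ∧ t.ge 0 ≤ Tfd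

end General

section Systems

variable {T : Type u} [Category.{v} T] [Preadditive T] [HasZeroObject T] [HasShift T ℤ]
  [∀ m : ℤ, (shiftFunctor T m).Additive] [Pretriangulated T]

/-- The inverse system `⋯ ⟶ X^{≤ -2} ⟶ X^{≤ -1} ⟶ X^{≤ 0}`. -/
def towerLE (t : TStructure T) (X : T) : ℕᵒᵖ ⥤ T where
  obj p := (t.truncLE (-(p.unop : ℤ))).obj X
  map {p q} f := (t.natTransTruncLEOfLE (-(p.unop : ℤ)) (-(q.unop : ℤ))
    (by have := leOfHom f.unop; lia)).app X
  map_id _ := t.natTransTruncLEOfLE_refl_app _ X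
  map_comp _ _ := (t.natTransTruncLEOfLE_trans_app _ _ _ _ _ X).symm

/-- The objects `X, X^{≤ 0}, X^{≤ -1}, X^{≤ -2}, …`. -/
def augTowerObj (t : TStructure T) (X : T) : ℕ → T
  | 0 => X
  | p + 1 => (t.truncLE (-(p : ℤ))).obj X

/-- The morphisms `X^{≤ 0} ⟶ X` and `X^{≤ -(p+1)} ⟶ X^{≤ -p}`. -/
def augTowerHom (t : TStructure T) (X : T) :
    ∀ p : ℕ, augTowerObj t X (p + 1) ⟶ augTowerObj t X p
  | 0 => (t.truncLEι (-((0 : ℕ) : ℤ))).app X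
  | p + 1 => (t.natTransTruncLEOfLE (-((p + 1 : ℕ) : ℤ)) (-(p : ℤ)) (by push_cast; lia)).app X

/-- The inverse system `⋯ ⟶ X^{≤ -2} ⟶ X^{≤ -1} ⟶ X^{≤ 0} ⟶ X`. -/
def augTowerLE (t : TStructure T) (X : T) : ℕᵒᵖ ⥤ T :=
  Functor.ofOpSequence (augTowerHom t X)

/-- The inverse system `⋯ ⟶ X^{≥ -1} ⟶ X^{≥ 0} ⟶ X^{≥ 1}`, with `X^{≥ -p+1}` in degree `p`. -/
def towerGE (t : TStructure T) (X : T) : ℕᵒᵖ ⥤ T where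
  obj p := (t.truncGE (-(p.unop : ℤ) + 1)).obj X
  map {p q} f := (t.natTransTruncGEOfLE (-(p.unop : ℤ) + 1) (-(q.unop : ℤ) + 1)
    (by have := leOfHom f.unop; lia)).app X
  map_id _ := congr_app (t.natTransTruncGEOfLE_refl _) X
  map_comp _ _ := (congr_app (t.natTransTruncGEOfLE_trans _ _ _ _ _) X).symm

/-- The first morphism of the triangle
`Σ⁻¹ X^{≥ -p+1} ⟶ X^{≤ -p} ⟶ X ⟶ X^{≥ -p+1}` obtained by rotating the truncation triangle. -/
def connecting (t : TStructure T) (X : T) (p : ℕ) :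
    ((towerGE t X).obj (op p))⟦(-1 : ℤ)⟧ ⟶ (towerLE t X).obj (op p) :=
  ((t.triangleLEGE (-(p : ℤ)) (-(p : ℤ) + 1) rfl).obj X).invRotate.mor₁

variable (k : Type w) [Field k] [Linear k T]

/-- The direct system `T(X, Y) ⟶ T(X^{≤ 0}, Y) ⟶ T(X^{≤ -1}, Y) ⟶ ⋯` of `k`-vector spaces. -/
def augHomSystem (t : TStructure T) (X Y : T) : ℕ ⥤ ModuleCat.{v} k :=
  (augTowerLE t X).rightOp ⋙ (linearYoneda k T).obj Y

/-- The direct system `p ↦ T(X^{≤ -p}, Y)` of `k`-vector spaces. -/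
def homSystem (t : TStructure T) (X Y : T) : ℕ ⥤ ModuleCat.{v} k :=
  (towerLE t X).rightOp ⋙ (linearYoneda k T).obj Y

/-- The direct system `p ↦ T(Σ⁻¹ X^{≥ -p+1}, Z)` of `k`-vector spaces, as a functor of `Z`. -/
def connectingSystem (t : TStructure T) (X : T) : T ⥤ ℕ ⥤ ModuleCat.{v} k :=
  linearYoneda k T ⋙
    (Functor.whiskeringLeft ℕ Tᵒᵖ (ModuleCat.{v} k)).obj
      (towerGE t X ⋙ shiftFunctor T (-1 : ℤ)).rightOp

/-- The inverse system `q ↦ colim_p T(Σ⁻¹ X^{≥ -p+1}, Y^{≤ -q})` of `k`-vector spaces. -/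
def doubleSystem (t : TStructure T) (X Y : T) : ℕᵒᵖ ⥤ ModuleCat.{v} k :=
  towerLE t Y ⋙ connectingSystem k t X ⋙ colim

end Systems

end CYTriple

end

/-! Everything rests on one vanishing statement and its two duals. Each `Y` has an `N` with `Hom(Y,
T^{≤ N}) = 0`: true on `𝓜`, and the class of such `Y` is thick (`exists_leftOrthogonal`). Calabi–Yau
duality turns this into vanishing of maps from `T^{≤ N}` to a given object of `Tfd`
(`exists_rightOrthogonal`), and from bounded-below objects of `T^{≤ N}` to `Y`
(`exists_bound_hom_from`).

By the first dual, `X^{≤ -p} ⟶ X`, whose cone lies in `Tfd` up to isomorphism, factors through any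
given denominator for large `p`, so these truncations suffice as denominators. By the second, the
transition maps are bijective for large `p`. This gives (a).

For (b), `Y^{≤ -q} ≅ Y` in the quotient, so (a) yields `colim_p T(X^{≤ -p}, Y^{≤ -q})`. Once `X` and
`Σ⁻¹X` have no maps to `Y^{≤ -q}`, precomposition with each `δ_p` is bijective, so the limit over
`q` is reached at a finite stage. -/

noncomputable section

namespace CYTriple

/-! ### Vanishing transported through Calabi–Yau duality. -/

section Duality

variable {T : Type u} [Category.{v} T] [Preadditive T] [HasShift T ℤ]
  {k : Type w} [Field k] [Linear k T] {n : ℕ} {Tfd : ObjectProperty T}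

/-- If `Hom(C⟦-n⟧, Z) = 0` with `C ∈ Tfd`, then `Hom(Z, C) = 0`. -/
lemma RelativeCYDuality.hom_to_eq_zero [Tfd.IsStableUnderShift ℤ] (D : RelativeCYDuality k n Tfd)
    {C Z : T} (hC : Tfd C) (h : ∀ f : C⟦(-(n : ℤ))⟧ ⟶ Z, f = 0) (f : Z ⟶ C) : f = 0 := by
  have hC' : Tfd (C⟦(-(n : ℤ))⟧) := Tfd.le_shift _ _ hC
  -- Duality for `C⟦-n⟧` describes maps to `C⟦-n⟧⟦n⟧`, which the counit identifies with `C`.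
  let e := (shiftEquiv T (n : ℤ)).counitIso.app C
  rw [← cancel_mono e.inv, zero_comp]
  have : Subsingleton (C⟦(-(n : ℤ))⟧ ⟶ Z) := ⟨fun a b => by rw [h a, h b]⟩
  have hs : Subsingleton (Module.Dual k (C⟦(-(n : ℤ))⟧ ⟶ Z)) := inferInstance
  exact ((D.iso _ Z hC').symm.injective.subsingleton).elim _ _

/-- If `Hom(Y, C⟦n⟧) = 0` with `C ∈ Tfd`, then `Hom(C, Y) = 0`. -/
lemma RelativeCYDuality.hom_from_eq_zero (D : RelativeCYDuality k n Tfd)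
    {C Y : T} (hC : Tfd C) (h : ∀ f : Y ⟶ C⟦(n : ℤ)⟧, f = 0) (f : C ⟶ Y) : f = 0 := by
  rw [← Module.forall_dual_apply_eq_zero_iff k]
  intro φ
  have : φ = 0 := (D.iso _ Y hC).injective (by rw [h (D.iso C Y hC φ), map_zero])
  rw [this, LinearMap.zero_apply]

end Duality

/-! ### Every object is left orthogonal to a deep enough aisle. -/

section Vanishing

variable {T : Type u} [Category.{v} T] [Preadditive T] [HasZeroObject T] [HasShift T ℤ]
  [∀ m : ℤ, (shiftFunctor T m).Additive] [Pretriangulated T]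

/-- The objects `Y` such that `Hom(Y, T^{≤ N}) = 0` for some integer `N`. -/
def eventuallyLeftOrthogonal (t : TStructure T) : ObjectProperty T := fun Y =>
  ∃ N : ℤ, (t.le N).leftOrthogonal Y

instance (t : TStructure T) : (eventuallyLeftOrthogonal t).IsStableUnderRetracts where
  of_retract := by
    rintro X Y r ⟨N, hN⟩
    refine ⟨N, fun Z f hZ => ?_⟩
    have := hN (r.r ≫ f) hZ
    rw [← id_comp f, ← r.retract, assoc, this, comp_zero]

instance (t : TStructure T) : (eventuallyLeftOrthogonal t).IsTriangulated where
  exists_zero := ⟨_, isZero_zero T, 0, fun _ _ _ => (isZero_zero T).eq_of_src _ _⟩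
  isStableUnderShiftBy a := ⟨by
    rintro Y ⟨N, hN⟩
    refine ⟨N - a, fun Z f hZ => ?_⟩
    apply (shiftFunctor T (-a)).map_injective
    let e : Y ≅ (Y⟦a⟧)⟦-a⟧ := (shiftEquiv T a).unitIso.app Y
    rw [Functor.map_zero, ← cancel_epi e.hom, comp_zero]
    have : t.IsLE Z (N - a) := ⟨hZ⟩
    exact hN _ (t.isLE_shift Z (N - a) (-a) N (by lia)).le⟩
  toIsTriangulatedClosed₂ := ⟨by
    rintro S hS ⟨N₁, h₁⟩ ⟨N₃, h₃⟩
    refine ObjectProperty.le_isoClosure _ _ ⟨min N₁ N₃, fun Z f hZ => ?_⟩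
    obtain ⟨g, rfl⟩ := Triangle.yoneda_exact₂ _ hS f
      (h₁ _ (t.le_monotone (min_le_left _ _) _ hZ))
    rw [h₃ g (t.le_monotone (min_le_right _ _) _ hZ), comp_zero]⟩

variable {𝓜 : ObjectProperty T} {t : TStructure T}

/-- The bound is `-1` because `T^{≤ 0}` is orthogonal only to strictly negative shifts of `𝓜`;
shifting a map `P ⟶ Z` by `-1` reaches that case. -/
lemma IsRightAdjacent.leftOrthogonal_le (ht : IsRightAdjacent 𝓜 t) :
    𝓜 ≤ (t.le (-1)).leftOrthogonal := by
  intro P hP Z f hZ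
  have : t.IsLE Z (-1) := ⟨hZ⟩
  have hZ' := (t.isLE_shift Z (-1) (-1) 0 (by lia)).le
  rw [ht.le_zero] at hZ'
  apply (shiftFunctor T (-1 : ℤ)).map_injective
  rw [Functor.map_zero]
  exact hZ' _ ⟨P, -1, hP, by lia, ⟨Iso.refl _⟩⟩

lemma IsRightAdjacent.exists_leftOrthogonal (ht : IsRightAdjacent 𝓜 t) (h𝓜 : IsSilting 𝓜)
    (Y : T) : ∃ N : ℤ, (t.le N).leftOrthogonal Y := by
  have h : 𝓜.triangEnvelope ≤ eventuallyLeftOrthogonal t :=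
    𝓜.triangEnvelope_le_iff.2 fun P hP => ⟨-1, ht.leftOrthogonal_le P hP⟩
  rw [h𝓜.thick_eq_top] at h
  exact h Y trivial

end Vanishing

/-! ### Sequential limits and colimits that are reached at a finite stage. -/

section SequentialLimits

variable {k : Type w} [Field k] {N : Type*} [AddCommGroup N] [Module k N]

/-- A compatible family of linear maps out of a direct system which is eventually bijective
identifies the target with the colimit. -/
lemma exists_colimit_linearEquiv (F : ℕ ⥤ ModuleCat.{v} k) (c : ∀ p, F.obj p →ₗ[k] N)
    (hc : ∀ ⦃p q : ℕ⦄ (f : p ⟶ q) (x : F.obj p), c q ((F.map f).hom x) = c p x)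
    (p₀ : ℕ) (hp₀ : ∀ p, p₀ ≤ p → Function.Bijective (c p)) :
    ∃ e : ↥(colimit F) ≃ₗ[k] N, ∀ p (x : F.obj p), e ((colimit.ι F p).hom x) = c p x := by
  let e₀ := LinearEquiv.ofBijective (c p₀) (hp₀ p₀ le_rfl)
  let s : Cocone F :=
    { pt := F.obj p₀
      ι :=
        { app p := ModuleCat.ofHom (e₀.symm.toLinearMap ∘ₗ c p)
          naturality p q f := by
            ext x
            simp [hc] } }
  have hs (p) (x : F.obj p) : e₀ ((s.ι.app p).hom x) = c p x := by simp [s]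
  have h₁ : colimit.desc F s ≫ colimit.ι F p₀ = 𝟙 _ := by
    refine colimit.hom_ext fun p => ?_
    ext x
    -- Elements of stages `p` and `p₀` are compared at a common later stage, where `c q` is
    -- injective.
    obtain ⟨q, hpq, hq⟩ : ∃ q, p ≤ q ∧ p₀ ≤ q := ⟨max p p₀, le_max_left _ _, le_max_right _ _⟩
    have h : (F.map (homOfLE hq)).hom ((s.ι.app p).hom x) = (F.map (homOfLE hpq)).hom x :=
      (hp₀ q hq).1 (by rw [hc, hc]; exact hs p x)
    have hw {i : ℕ} (hi : i ≤ q) (y : F.obj i) :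
        (colimit.ι F q).hom ((F.map (homOfLE hi)).hom y) = (colimit.ι F i).hom y :=
      congr($(colimit.w F (homOfLE hi)).hom y)
    have h' := congr((colimit.ι F q).hom $h)
    rw [hw, hw] at h'
    rw [colimit.ι_desc_assoc, comp_id]
    exact h'
  have h₂ : colimit.ι F p₀ ≫ colimit.desc F s = 𝟙 _ := by
    rw [colimit.ι_desc]
    ext x
    exact e₀.injective (hs p₀ x)
  let e : colimit F ≅ F.obj p₀ := ⟨_, _, h₁, h₂⟩
  refine ⟨e.toLinearEquiv.trans e₀, fun p x => ?_⟩
  rw [← hs p x, LinearEquiv.trans_apply]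
  congr 1
  exact congr($(colimit.ι_desc s p).hom x)

/-- A compatible family of linear maps into an inverse system which is eventually bijective
identifies the source with the limit. -/
lemma exists_limit_linearEquiv (F : ℕᵒᵖ ⥤ ModuleCat.{v} k) (c : ∀ q, N →ₗ[k] F.obj (op q))
    (hc : ∀ ⦃p q : ℕ⦄ (f : p ⟶ q) (x : N), (F.map f.op).hom (c q x) = c p x)
    (q₀ : ℕ) (hq₀ : ∀ q, q₀ ≤ q → Function.Bijective (c q)) :
    ∃ e : ↥(limit F) ≃ₗ[k] N, ∀ q (x : N), (limit.π F (op q)).hom (e.symm x) = c q x := by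
  let e₀ := LinearEquiv.ofBijective (c q₀) (hq₀ q₀ le_rfl)
  let s : Cone F :=
    { pt := F.obj (op q₀)
      π :=
        { app q := ModuleCat.ofHom (c q.unop ∘ₗ e₀.symm.toLinearMap)
          naturality p q f := by
            ext x
            exact (hc f.unop (e₀.symm x)).symm } }
  have hs (q) (x : N) : (s.π.app (op q)).hom (e₀ x) = c q x := by simp [s]
  have h₁ : limit.π F (op q₀) ≫ limit.lift F s = 𝟙 _ := by
    refine limit.hom_ext fun q => ?_
    ext x
    obtain ⟨m, hqm, hm⟩ : ∃ m, q.unop ≤ m ∧ q₀ ≤ m :=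
      ⟨max q.unop q₀, le_max_left _ _, le_max_right _ _⟩
    obtain ⟨y, hy⟩ := (hq₀ m hm).2 ((limit.π F (op m)).hom x)
    have hy' (q : ℕ) (hq : q ≤ m) : c q y = (limit.π F (op q)).hom x := by
      rw [← hc (homOfLE hq), hy]
      exact congr($(limit.w F (homOfLE hq).op).hom x)
    have h : (limit.π F (op q₀)).hom x = e₀ y := (hy' q₀ hm).symm
    have := hs q.unop y
    rw [hy' _ hqm, ← h] at this
    simpa using this
  have h₂ : limit.lift F s ≫ limit.π F (op q₀) = 𝟙 _ := by
    rw [limit.lift_π]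
    ext x
    exact e₀.apply_symm_apply x
  let e : limit F ≅ F.obj (op q₀) := ⟨_, _, h₁, h₂⟩
  refine ⟨e.toLinearEquiv.trans e₀.symm, fun q x => ?_⟩
  rw [← hs q x]
  exact congr($(limit.lift_π s (op q)).hom (e₀ x))

lemma isEventuallyConstantFrom_of_succ {C : Type*} [Category* C] (F : ℕ ⥤ C) (p₀ : ℕ)
    (h : ∀ p, p₀ ≤ p → IsIso (F.map (homOfLE (Nat.le_succ p)))) :
    F.IsEventuallyConstantFrom p₀ := by
  intro q f
  suffices ∀ hq : p₀ ≤ q, IsIso (F.map (homOfLE hq)) from this (leOfHom f)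
  clear f
  intro hq
  induction q, hq using Nat.le_induction with
  | base => exact (F.map_id _).symm ▸ inferInstance
  | succ q hq ih =>
    have := h q hq
    rw [← homOfLE_comp hq (Nat.le_succ q), F.map_comp]
    infer_instance

end SequentialLimits

/-! ### Truncation triangles and precomposition. -/

section Truncation

variable {T : Type u} [Category.{v} T] [Preadditive T] [HasZeroObject T] [HasShift T ℤ]
  [∀ m : ℤ, (shiftFunctor T m).Additive] [Pretriangulated T]

/-- The isomorphism closure appears because `X` is only isomorphic to `X⟦m⟧⟦-m⟧`, and `P` need not
be closed under isomorphisms. -/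
lemma ge_le_isoClosure {t : TStructure T} {P : ObjectProperty T} [P.IsStableUnderShift ℤ]
    (h : t.ge 0 ≤ P) (m : ℤ) : t.ge m ≤ P.isoClosure := by
  intro X hX
  have : t.IsGE X m := ⟨hX⟩
  exact ⟨_, P.le_shift (-m) _ (h _ (t.isGE_shift X m m 0 (by lia)).ge),
    ⟨(shiftEquiv T m).unitIso.app X⟩⟩

/-- In a distinguished triangle `X₁ ⟶ X₂ ⟶ X₃ ⟶ X₁⟦1⟧`, precomposition with `X₁ ⟶ X₂` is
bijective on morphisms to `Y` if `Hom(X₃, Y) = 0` and `Hom(X₃⟦-1⟧, Y) = 0`. -/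
lemma precomp_bijective_of_distTriang (S : Triangle T) (hS : S ∈ distTriang T) {Y : T}
    (h : ∀ f : S.obj₃ ⟶ Y, f = 0) (h' : ∀ f : S.obj₃⟦(-1 : ℤ)⟧ ⟶ Y, f = 0) :
    Function.Bijective fun g : S.obj₂ ⟶ Y => S.mor₁ ≫ g := by
  constructor
  · intro g₁ g₂ hg
    obtain ⟨a, ha⟩ := Triangle.yoneda_exact₂ _ hS (g₁ - g₂)
      (by rw [Preadditive.comp_sub, sub_eq_zero]; exact hg)
    rwa [h a, comp_zero, sub_eq_zero] at ha
  · intro g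
    obtain ⟨a, ha⟩ := Triangle.yoneda_exact₂ _ (inv_rot_of_distTriang _ hS) g (h' _)
    exact ⟨a, ha.symm⟩

variable (t : TStructure T)

lemma connecting_precomp_bijective (X : T) (p : ℕ) {Z : T}
    (h : ∀ f : X ⟶ Z, f = 0) (h' : ∀ f : X⟦(-1 : ℤ)⟧ ⟶ Z, f = 0) :
    Function.Bijective fun g : (towerLE t X).obj (op p) ⟶ Z => connecting t X p ≫ g :=
  precomp_bijective_of_distTriang _
    (inv_rot_of_distTriang _ (t.triangleLEGE_distinguished _ _ rfl X)) h h'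

lemma connecting_naturality (X : T) {p q : ℕ} (f : p ⟶ q) :
    ((towerGE t X).map f.op)⟦(-1 : ℤ)⟧' ≫ connecting t X p =
      connecting t X q ≫ (towerLE t X).map f.op := by
  have hpq : -(q : ℤ) ≤ -(p : ℤ) := by have := leOfHom f; lia
  let φ : (t.triangleLEGE (-(q : ℤ)) (-(q : ℤ) + 1) rfl).obj X ⟶
      (t.triangleLEGE (-(p : ℤ)) (-(p : ℤ) + 1) rfl).obj X :=
    { hom₁ := (t.natTransTruncLEOfLE _ _ hpq).app X
      hom₂ := 𝟙 X
      hom₃ := (t.natTransTruncGEOfLE _ _ (by lia)).app X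
      comm₁ := (comp_id _).trans (t.natTransTruncLEOfLE_ι_app _ _ hpq X).symm
      comm₂ := (t.π_natTransTruncGEOfLE_app _ _ _ X).trans (id_comp _).symm
      comm₃ := by
        -- The two connecting maps differ by the shift of an identity, so the known naturality of
        -- `truncGEδLT` applies.
        have h (a : ℤ) : (t.truncGEδLE a (a + 1) rfl).app X = (t.truncGEδLT (a + 1)).app X := by
          change _ ≫ (shiftFunctor T (1 : ℤ)).map (𝟙 ((t.truncLE a).obj X)) = _
          exact (congrArg (_ ≫ ·) ((shiftFunctor T (1 : ℤ)).map_id _)).trans (comp_id _)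
        have := t.truncGEδLT_comp_natTransTruncLTOfLE_app (-(q : ℤ) + 1) (-(p : ℤ) + 1)
          (by lia) X
        rw [← h, ← h] at this
        exact this }
  exact ((invRotate T).map φ).comm₁.symm

variable [IsTriangulated T]

/-- The cone `C` of `X^{≤ a} ⟶ X^{≤ b}` is concentrated in degrees `a + 1` to `b`. Strictness of `b
< N` leaves room for `C⟦-1⟧`, which lies in `T^{≤ b + 1}`. -/
lemma natTransTruncLEOfLE_precomp_bijective {Y : T} {N : ℤ}
    (hY : ∀ (C : T) (m : ℤ), t.ge m C → t.le N C → ∀ f : C ⟶ Y, f = 0)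
    (a b : ℤ) (hab : a ≤ b) (hb : b < N) (X : T) :
    Function.Bijective fun g : (t.truncLE b).obj X ⟶ Y =>
      (t.natTransTruncLEOfLE a b hab).app X ≫ g := by
  let C := (t.truncGELT (a + 1) (b + 1)).obj X
  have hge : t.IsGE C (a + 1) :=
    inferInstanceAs (t.IsGE ((t.truncGELT (a + 1) (b + 1)).obj X) (a + 1))
  have hle : t.IsLE C (b + 1 - 1) :=
    inferInstanceAs (t.IsLE ((t.truncGELT (a + 1) (b + 1)).obj X) (b + 1 - 1))
  have hge' := t.isGE_shift C (a + 1) (-1) (a + 2) (by lia)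
  have hle' := t.isLE_shift C (b + 1 - 1) (-1) (b + 1) (by lia)
  exact precomp_bijective_of_distTriang _
    (t.triangleLTLTGELT_distinguished (a + 1) (b + 1) (by lia) X)
    (hY C _ hge.ge (t.le_monotone (by lia) _ hle.le))
    (hY (C⟦(-1 : ℤ)⟧) _ hge'.ge (t.le_monotone (by lia) _ hle'.le))

end Truncation

/-! ### Denominators with cone in `Tfd`. -/

section Fractions

variable {k : Type w} [Field k] {T : Type u} [Category.{v} T] [Preadditive T]
  [HasZeroObject T] [HasShift T ℤ] [∀ m : ℤ, (shiftFunctor T m).Additive]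
  [Pretriangulated T] [Linear k T] {n : ℕ} {Tfd 𝓜 : ObjectProperty T} {t : TStructure T}

namespace IsCYTriple

lemma ge_le_isoClosure [Tfd.IsStableUnderShift ℤ] (hCY : IsCYTriple k n Tfd 𝓜)
    (ht : IsRightAdjacent 𝓜 t) (m : ℤ) : t.ge m ≤ Tfd.isoClosure := by
  obtain ⟨t', ht', hge⟩ := hCY.exists_tStructure
  -- `t'` and `t` have the same coaisle, as both are right adjacent to `𝓜`.
  rw [ht'.ge_zero, ← ht.ge_zero] at hge
  exact CYTriple.ge_le_isoClosure hge m

lemma trW_truncLEι [Tfd.IsStableUnderShift ℤ] (hCY : IsCYTriple k n Tfd 𝓜)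
    (ht : IsRightAdjacent 𝓜 t) (m : ℤ) (X : T) : Tfd.trW ((t.truncLEι m).app X) := by
  rw [← Tfd.trW_isoClosure]
  exact ⟨_, _, _, t.triangleLEGE_distinguished m _ rfl X,
    hCY.ge_le_isoClosure ht (m + 1) _ (t.isGE_truncGE_obj X _ _).ge⟩

/-- Objects of `Tfd` receive no nonzero morphisms from `T^{≤ N}` for `N` small enough. -/
lemma exists_rightOrthogonal [Tfd.IsStableUnderShift ℤ] (hCY : IsCYTriple k n Tfd 𝓜)
    (ht : IsRightAdjacent 𝓜 t) {C : T} (hC : Tfd C) :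
    ∃ N : ℤ, (t.le N).rightOrthogonal C := by
  obtain ⟨D⟩ := hCY.relativeCY
  obtain ⟨N, hN⟩ := ht.exists_leftOrthogonal hCY.silting (C⟦(-(n : ℤ))⟧)
  exact ⟨N, fun Z f hZ => D.hom_to_eq_zero hC (fun g => hN g hZ) f⟩

/-- For `N` small enough, there are no nonzero morphisms to `Y` from the objects of `T^{≤ N}`
which are bounded below. -/
lemma exists_bound_hom_from [Tfd.IsStableUnderShift ℤ] (hCY : IsCYTriple k n Tfd 𝓜)
    (ht : IsRightAdjacent 𝓜 t) (Y : T) :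
    ∃ N : ℤ, ∀ (C : T) (m : ℤ), t.ge m C → t.le N C → ∀ f : C ⟶ Y, f = 0 := by
  obtain ⟨D⟩ := hCY.relativeCY
  obtain ⟨N, hN⟩ := ht.exists_leftOrthogonal hCY.silting Y
  refine ⟨N, fun C m hm hC f => ?_⟩
  obtain ⟨C', hC', ⟨e⟩⟩ := hCY.ge_le_isoClosure ht m C hm
  rw [← cancel_epi e.inv, comp_zero]
  refine D.hom_from_eq_zero hC' (fun g => hN g ?_) _
  have : t.IsLE C' N := ⟨(t.le N).prop_of_iso e hC⟩
  -- `C'⟦n⟧` lies in `T^{≤ N - n}`, hence in `T^{≤ N}` since `n ≥ 0`.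
  exact t.le_monotone (by lia) _ (t.isLE_shift C' N n (N - n) (by lia)).le

/-- Morphisms from `T^{≤ N}` lift along a given morphism with cone in `Tfd` for `N` small
enough. -/
lemma exists_lift_of_trW [Tfd.IsStableUnderShift ℤ] (hCY : IsCYTriple k n Tfd 𝓜)
    (ht : IsRightAdjacent 𝓜 t) {X' X : T} {s : X' ⟶ X} (hs : Tfd.trW s) :
    ∃ N : ℤ, ∀ ⦃Z : T⦄, t.le N Z → ∀ f : Z ⟶ X, ∃ g : Z ⟶ X', f = g ≫ s := by
  obtain ⟨C, a, b, hT, hC⟩ := hs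
  obtain ⟨N, hN⟩ := hCY.exists_rightOrthogonal ht hC
  exact ⟨N, fun Z hZ f => Triangle.coyoneda_exact₂ _ hT f (hN _ hZ)⟩

end IsCYTriple

/-- The map `g ↦ Q(s)⁻¹ ≫ Q(g)` for a morphism `s` with cone in `Tfd`. -/
def fractionMap (k : Type w) [Field k] [Linear k T]
    [IsTriangulated T] (Tfd : ObjectProperty T) [Tfd.IsTriangulated] {X' X : T} (s : X' ⟶ X)
    (hs : Tfd.trW s) (Y : T) :
    (X' ⟶ Y) →ₗ[k] (Tfd.trW.Q.obj X ⟶ Tfd.trW.Q.obj Y) :=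
  Linear.leftComp k _ (Localization.isoOfHom Tfd.trW.Q Tfd.trW s hs).inv ∘ₗ
    Tfd.trW.Q.mapLinearMap k

lemma fractionMap_eq_iff [IsTriangulated T] [Tfd.IsTriangulated] {X' X Y : T} {s : X' ⟶ X}
    (hs : Tfd.trW s) (g : X' ⟶ Y) (φ : Tfd.trW.Q.obj X ⟶ Tfd.trW.Q.obj Y) :
    fractionMap k Tfd s hs Y g = φ ↔ Tfd.trW.Q.map s ≫ φ = Tfd.trW.Q.map g := by
  change (Localization.isoOfHom Tfd.trW.Q Tfd.trW s hs).inv ≫ Tfd.trW.Q.map g = φ ↔ _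
  rw [Iso.inv_comp_eq, Localization.isoOfHom_hom, eq_comm]

lemma fractionMap_comp [IsTriangulated T] [Tfd.IsTriangulated] {X'' X' X Y : T} {s' : X'' ⟶ X}
    {s : X' ⟶ X} (hs' : Tfd.trW s') (hs : Tfd.trW s) (a : X'' ⟶ X') (h : a ≫ s = s')
    (g : X' ⟶ Y) :
    fractionMap k Tfd s' hs' Y (a ≫ g) = fractionMap k Tfd s hs Y g := by
  rw [fractionMap_eq_iff, Functor.map_comp, ← (fractionMap_eq_iff (k := k) hs g _).1 rfl, ← h,
    Functor.map_comp, assoc]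

end Fractions

/-! ### Comparison of the two direct systems via `δ_p`. -/

section Connecting

variable {k : Type w} [Field k] {T : Type u} [Category.{v} T] [Preadditive T]
  [HasZeroObject T] [HasShift T ℤ] [∀ m : ℤ, (shiftFunctor T m).Additive]
  [Pretriangulated T] [Linear k T] {t : TStructure T}

variable (k t) in
/-- The morphism of direct systems `T(X^{≤ -p}, Z) ⟶ T(Σ⁻¹ X^{≥ -p+1}, Z)`. -/
def connectingNatTrans (X Z : T) : homSystem k t X Z ⟶ (connectingSystem k t X).obj Z where
  app p := ModuleCat.ofHom (Linear.leftComp k Z (connecting t X p))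
  naturality p q f := by
    ext g
    have h (g : (towerLE t X).obj (op p) ⟶ Z) : connecting t X q ≫ (towerLE t X).map f.op ≫ g =
        ((towerGE t X).map f.op)⟦(-1 : ℤ)⟧' ≫ connecting t X p ≫ g := by
      rw [← assoc, ← assoc, connecting_naturality]
    exact h g

lemma ι_colimMap_connectingNatTrans (X Z : T) (p : ℕ) (g : (towerLE t X).obj (op p) ⟶ Z) :
    (colimMap (connectingNatTrans k t X Z)).hom ((colimit.ι (homSystem k t X Z) p).hom g) =
      (colimit.ι ((connectingSystem k t X).obj Z) p).hom (connecting t X p ≫ g) :=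
  congr($(ι_colimMap (connectingNatTrans k t X Z) p).hom g)

lemma isIso_colimMap_connectingNatTrans (X Z : T)
    (h : ∀ f : X ⟶ Z, f = 0) (h' : ∀ f : X⟦(-1 : ℤ)⟧ ⟶ Z, f = 0) :
    IsIso (colimMap (connectingNatTrans k t X Z)) := by
  have (p : ℕ) : IsIso ((connectingNatTrans k t X Z).app p) := by
    rw [ConcreteCategory.isIso_iff_bijective]
    exact connecting_precomp_bijective t X p h h'
  have : IsIso (connectingNatTrans k t X Z) := NatIso.isIso_of_isIso_app _
  infer_instance

end Connecting

/-! ### Morphisms in the Verdier quotient. -/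

section Quotient

variable {k : Type w} [Field k] {T : Type u} [Category.{v} T] [Preadditive T]
  [HasZeroObject T] [HasShift T ℤ] [∀ m : ℤ, (shiftFunctor T m).Additive]
  [Pretriangulated T] [IsTriangulated T] [Linear k T]
  {n : ℕ} {Tfd 𝓜 : ObjectProperty T} [Tfd.IsTriangulated] {t : TStructure T}

namespace IsCYTriple

/-- Every morphism in `T/Tfd` is a fraction with denominator `X^{≤ -p} ⟶ X`, with `p`
arbitrarily large. -/
lemma exists_fraction (hCY : IsCYTriple k n Tfd 𝓜) (ht : IsRightAdjacent 𝓜 t) {X Y : T}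
    (φ : Tfd.trW.Q.obj X ⟶ Tfd.trW.Q.obj Y) (p₀ : ℕ) :
    ∃ (p : ℕ) (_ : p₀ ≤ p) (g : (t.truncLE (-(p : ℤ))).obj X ⟶ Y),
      Tfd.trW.Q.map ((t.truncLEι (-(p : ℤ))).app X) ≫ φ = Tfd.trW.Q.map g := by
  obtain ⟨⟨s, hs, u⟩, rfl⟩ := Localization.exists_rightFraction Tfd.trW.Q Tfd.trW φ
  obtain ⟨N, hN⟩ := hCY.exists_lift_of_trW ht hs
  -- With `-p ≤ N`, the map `X^{≤ -p} ⟶ X` factors through the denominator `s`.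
  let p : ℕ := max p₀ (-N).toNat
  obtain ⟨g, hg⟩ := hN (t.isLE_truncLE_obj X (-(p : ℤ)) N (by lia)).le
    ((t.truncLEι (-(p : ℤ))).app X)
  refine ⟨p, le_max_left _ _, g ≫ u, ?_⟩
  rw [hg, Functor.map_comp, assoc, Functor.map_comp]
  exact congrArg (_ ≫ ·) (MorphismProperty.RightFraction.map_s_comp_map ⟨s, hs, u⟩ _ _)

/-- A morphism `X^{≤ -p} ⟶ Y` which vanishes in `T/Tfd` vanishes on `X^{≤ -q}` for some
`q ≥ p`. -/
lemma exists_natTrans_comp_eq_zero (hCY : IsCYTriple k n Tfd 𝓜) (ht : IsRightAdjacent 𝓜 t)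
    {X Y : T} {p : ℕ} (g : (t.truncLE (-(p : ℤ))).obj X ⟶ Y) (hg : Tfd.trW.Q.map g = 0) :
    ∃ (q : ℕ) (h : p ≤ q),
      (t.natTransTruncLEOfLE (-(q : ℤ)) (-(p : ℤ)) (by lia)).app X ≫ g = 0 := by
  rw [← Functor.map_zero, MorphismProperty.map_eq_iff_precomp Tfd.trW.Q Tfd.trW] at hg
  obtain ⟨X', s, hs, hsg⟩ := hg
  obtain ⟨N, hN⟩ := hCY.exists_lift_of_trW ht hs
  let q : ℕ := max p (-N).toNat
  have hpq : p ≤ q := le_max_left _ _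
  obtain ⟨a, ha⟩ := hN (t.isLE_truncLE_obj X (-(q : ℤ)) N (by lia)).le
    ((t.natTransTruncLEOfLE (-(q : ℤ)) (-(p : ℤ)) (by lia)).app X)
  exact ⟨q, hpq, by rw [ha, assoc, hsg, comp_zero, comp_zero]⟩

lemma exists_precomp_bijective (hCY : IsCYTriple k n Tfd 𝓜) (ht : IsRightAdjacent 𝓜 t)
    (X Y : T) : ∃ p₀ : ℕ, ∀ (p q : ℕ) (_ : p₀ ≤ p) (h : p ≤ q), Function.Bijective
      fun g : (t.truncLE (-(p : ℤ))).obj X ⟶ Y =>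
        (t.natTransTruncLEOfLE (-(q : ℤ)) (-(p : ℤ)) (by lia)).app X ≫ g := by
  obtain ⟨N, hN⟩ := hCY.exists_bound_hom_from ht Y
  exact ⟨(-N).toNat + 1, fun p q hp h =>
    natTransTruncLEOfLE_precomp_bijective t hN _ _ _ (by lia) X⟩

lemma exists_isEventuallyConstantFrom (hCY : IsCYTriple k n Tfd 𝓜) (ht : IsRightAdjacent 𝓜 t)
    (X Y : T) : ∃ p : ℕ, (augHomSystem k t X Y).IsEventuallyConstantFrom p := by
  obtain ⟨p₀, hp₀⟩ := hCY.exists_precomp_bijective ht X Y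
  -- Index `0` of the augmented tower is `X` itself, so `X^{≤ -p}` sits at index `p + 1`.
  refine ⟨p₀ + 1, isEventuallyConstantFrom_of_succ _ _ fun p hp => ?_⟩
  obtain _ | p := p
  · lia
  rw [ConcreteCategory.isIso_iff_bijective]
  have h : (augHomSystem k t X Y).map (homOfLE (Nat.le_succ (p + 1))) =
      ((linearYoneda k T).obj Y).map (augTowerHom t X (p + 1)).op := by
    refine congrArg (fun f => ((linearYoneda k T).obj Y).map (Quiver.Hom.op f)) ?_
    exact Functor.ofOpSequence_map_homOfLE_succ _ _
  rw [h]
  exact hp₀ p (p + 1) (by lia) (by lia)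

/-- Vanishing in the quotient, and representation by a fraction, are only available at some later
stage `q`; bijectivity of the transition maps brings both back to `p`. -/
lemma exists_fractionMap_bijective (hCY : IsCYTriple k n Tfd 𝓜) (ht : IsRightAdjacent 𝓜 t)
    (X Y : T) : ∃ p₀ : ℕ, ∀ p : ℕ, p₀ ≤ p → Function.Bijective
      (fractionMap k Tfd ((t.truncLEι (-(p : ℤ))).app X) (hCY.trW_truncLEι ht _ X) Y) := by
  obtain ⟨p₀, hp₀⟩ := hCY.exists_precomp_bijective ht X Y
  refine ⟨p₀, fun p hp => ⟨?_, fun (φ : Tfd.trW.Q.obj X ⟶ Tfd.trW.Q.obj Y) => ?_⟩⟩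
  · rw [injective_iff_map_eq_zero]
    intro g hg
    rw [fractionMap_eq_iff, comp_zero] at hg
    obtain ⟨q, hpq, hq⟩ := hCY.exists_natTrans_comp_eq_zero ht g hg.symm
    exact (hp₀ p q hp hpq).1 (hq.trans comp_zero.symm)
  · obtain ⟨q, hpq, g, hg⟩ := hCY.exists_fraction ht φ p
    obtain ⟨g', rfl⟩ := (hp₀ p q hp hpq).2 g
    refine ⟨g', Eq.trans ?_ ((fractionMap_eq_iff (k := k) (hCY.trW_truncLEι ht _ X) _ _).2 hg)⟩
    exact (fractionMap_comp _ _ _ (t.natTransTruncLEOfLE_ι_app _ _ _ X) g').symm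

lemma exists_colimit_homSystem_linearEquiv (hCY : IsCYTriple k n Tfd 𝓜)
    (ht : IsRightAdjacent 𝓜 t) (X Y : T) :
    ∃ e : ↥(colimit (homSystem k t X Y)) ≃ₗ[k] (Tfd.trW.Q.obj X ⟶ Tfd.trW.Q.obj Y),
      ∀ (p : ℕ) (g : (t.truncLE (-(p : ℤ))).obj X ⟶ Y),
        Tfd.trW.Q.map ((t.truncLEι (-(p : ℤ))).app X) ≫
            e ((colimit.ι (homSystem k t X Y) p).hom g) = Tfd.trW.Q.map g := by
  obtain ⟨p₀, hp₀⟩ := hCY.exists_fractionMap_bijective ht X Y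
  let c (p : ℕ) : (homSystem k t X Y).obj p →ₗ[k] (Tfd.trW.Q.obj X ⟶ Tfd.trW.Q.obj Y) :=
    fractionMap k Tfd ((t.truncLEι (-(p : ℤ))).app X) (hCY.trW_truncLEι ht _ X) Y
  have hc ⦃p q : ℕ⦄ (f : p ⟶ q) (g : (homSystem k t X Y).obj p) :
      c q (((homSystem k t X Y).map f).hom g) = c p g :=
    fractionMap_comp _ _ _ (t.natTransTruncLEOfLE_ι_app (-(q : ℤ)) (-(p : ℤ))
      (by have := leOfHom f; lia) X) g
  obtain ⟨e, he⟩ := exists_colimit_linearEquiv (homSystem k t X Y) c hc p₀ hp₀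
  exact ⟨e, fun p g => (fractionMap_eq_iff _ _ _).1 (he p g).symm⟩

/-- The map composes with the inverse of `Q(Y^{≤ -q} ⟶ Y)`, then applies the inverse of the colimit
isomorphism of (a) for `Y^{≤ -q}`, then the maps induced by `δ_p`. Only the last can fail to be
bijective. -/
lemma exists_connecting_linearMap (hCY : IsCYTriple k n Tfd 𝓜) (ht : IsRightAdjacent 𝓜 t)
    (X Y : T) (q : ℕ) :
    ∃ c : (Tfd.trW.Q.obj X ⟶ Tfd.trW.Q.obj Y) →ₗ[k] (doubleSystem k t X Y).obj (op q),
      (∀ (φ : Tfd.trW.Q.obj X ⟶ Tfd.trW.Q.obj Y) (p : ℕ)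
        (g : (t.truncLE (-(p : ℤ))).obj X ⟶ (t.truncLE (-(q : ℤ))).obj Y),
        Tfd.trW.Q.map ((t.truncLEι (-(p : ℤ))).app X) ≫ φ =
            Tfd.trW.Q.map (g ≫ (t.truncLEι (-(q : ℤ))).app Y) →
        c φ = (colimit.ι ((connectingSystem k t X).obj ((towerLE t Y).obj (op q))) p).hom
            (connecting t X p ≫ g)) ∧
      ((t.le (-(q : ℤ))).leftOrthogonal X → (t.le (-(q : ℤ))).leftOrthogonal (X⟦(-1 : ℤ)⟧) →
        Function.Bijective c) := by
  let Z := (towerLE t Y).obj (op q)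
  have hZ : t.le (-(q : ℤ)) Z := (t.isLE_truncLE_obj Y (-(q : ℤ)) _ le_rfl).le
  obtain ⟨e, he⟩ := hCY.exists_colimit_homSystem_linearEquiv ht X Z
  let i : Tfd.trW.Q.obj Z ≅ Tfd.trW.Q.obj Y :=
    Localization.isoOfHom Tfd.trW.Q Tfd.trW _ (hCY.trW_truncLEι ht (-(q : ℤ)) Y)
  let j (p : ℕ) : Tfd.trW.Q.obj ((t.truncLE (-(p : ℤ))).obj X) ≅ Tfd.trW.Q.obj X :=
    Localization.isoOfHom Tfd.trW.Q Tfd.trW _ (hCY.trW_truncLEι ht (-(p : ℤ)) X)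
  let d : (Tfd.trW.Q.obj X ⟶ Tfd.trW.Q.obj Y) ≃ₗ[k] (Tfd.trW.Q.obj X ⟶ Tfd.trW.Q.obj Z) :=
    Linear.homCongr k (Iso.refl _) i.symm
  refine ⟨(colimMap (connectingNatTrans k t X Z)).hom ∘ₗ (d.trans e.symm).toLinearMap,
    fun φ p (g : (t.truncLE (-(p : ℤ))).obj X ⟶ Z) h => ?_, fun h h' => ?_⟩
  · refine Eq.trans ?_ (ι_colimMap_connectingNatTrans X Z p g)
    refine congrArg (colimMap (connectingNatTrans k t X Z)).hom ?_
    change e.symm (d φ) = _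
    rw [LinearEquiv.symm_apply_eq]
    have hd : d φ = φ ≫ i.inv := by
      rw [Linear.homCongr_apply, Iso.refl_inv, id_comp, Iso.symm_hom]
    have h' : (j p).hom ≫ φ = Tfd.trW.Q.map g ≫ i.hom := h.trans (Tfd.trW.Q.map_comp _ _)
    have he' : (j p).hom ≫ e ((colimit.ι (homSystem k t X Z) p).hom g) = Tfd.trW.Q.map g := he p g
    rw [hd, ← cancel_epi (j p).hom, he', reassoc_of% h', i.hom_inv_id, comp_id]
  · have := isIso_colimMap_connectingNatTrans (k := k) (t := t) X Z
      (fun f => h f hZ) (fun f => h' f hZ)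
    exact ((ConcreteCategory.isIso_iff_bijective
      (colimMap (connectingNatTrans k t X Z))).1 this).comp (d.trans e.symm).bijective

lemma exists_limit_doubleSystem_linearEquiv (hCY : IsCYTriple k n Tfd 𝓜)
    (ht : IsRightAdjacent 𝓜 t) (X Y : T) :
    ∃ e : ↥(limit (doubleSystem k t X Y)) ≃ₗ[k] (Tfd.trW.Q.obj X ⟶ Tfd.trW.Q.obj Y),
      ∀ (φ : Tfd.trW.Q.obj X ⟶ Tfd.trW.Q.obj Y) (p q : ℕ)
        (g : (t.truncLE (-(p : ℤ))).obj X ⟶ (t.truncLE (-(q : ℤ))).obj Y),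
        Tfd.trW.Q.map ((t.truncLEι (-(p : ℤ))).app X) ≫ φ =
            Tfd.trW.Q.map (g ≫ (t.truncLEι (-(q : ℤ))).app Y) →
        (limit.π (doubleSystem k t X Y) (op q)).hom (e.symm φ) =
          (colimit.ι ((connectingSystem k t X).obj ((towerLE t Y).obj (op q))) p).hom
            (connecting t X p ≫ g) := by
  choose c hc hc' using fun q => hCY.exists_connecting_linearMap ht X Y q
  obtain ⟨N, hN⟩ := ht.exists_leftOrthogonal hCY.silting X
  obtain ⟨N', hN'⟩ := ht.exists_leftOrthogonal hCY.silting (X⟦(-1 : ℤ)⟧)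
  have hcomp ⦃q q' : ℕ⦄ (f : q ⟶ q') (φ : Tfd.trW.Q.obj X ⟶ Tfd.trW.Q.obj Y) :
      ((doubleSystem k t X Y).map f.op).hom (c q' φ) = c q φ := by
    -- Taking `p ≥ q'` puts `X^{≤ -p}` in `T^{≤ -q'}`, so the numerator lifts to `Y^{≤ -q'}`; this
    -- one lift computes both components.
    obtain ⟨p, hp, g₀, hg₀⟩ := hCY.exists_fraction ht φ q'
    have : t.IsLE ((t.truncLE (-(p : ℤ))).obj X) (-(q' : ℤ)) := t.isLE_truncLE_obj X _ _ (by lia)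
    obtain ⟨g, rfl⟩ : ∃ g, g₀ = g ≫ (t.truncLEι (-(q' : ℤ))).app Y := t.liftTruncLE_aux g₀ _
    have hqq' := leOfHom f
    let a : (t.truncLE (-(q' : ℤ))).obj Y ⟶ (t.truncLE (-(q : ℤ))).obj Y :=
      (t.natTransTruncLEOfLE (-(q' : ℤ)) (-(q : ℤ)) (by lia)).app Y
    have ha : a ≫ (t.truncLEι (-(q : ℤ))).app Y = (t.truncLEι (-(q' : ℤ))).app Y :=
      t.natTransTruncLEOfLE_ι_app _ _ (by lia) Y
    rw [hc q' φ p g hg₀, hc q φ p (g ≫ a) (by rw [hg₀, ← ha, assoc])]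
    refine congr($(ι_colimMap ((connectingSystem k t X).map ((towerLE t Y).map f.op)) p).hom
      (connecting t X p ≫ g)).trans ?_
    exact congrArg _ (assoc _ _ _)
  obtain ⟨e, he⟩ := exists_limit_linearEquiv (doubleSystem k t X Y) c hcomp
    (max (-N).toNat (-N').toNat) (fun q hq => hc' q
      (fun Z f hZ => hN f (t.le_monotone (by lia) _ hZ))
      (fun Z f hZ => hN' f (t.le_monotone (by lia) _ hZ)))
  exact ⟨e, fun φ p q g h => (he q φ).trans (hc q φ p g h)⟩

end IsCYTriple

end Quotient

end CYTriple

end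

open CYTriple in
theorem theoremA {k : Type w} [Field k] {T : Type u} [Category.{v} T] [Preadditive T]
    [HasZeroObject T] [HasShift T ℤ] [∀ m : ℤ, (shiftFunctor T m).Additive]
    [Pretriangulated T] [IsTriangulated T] [Linear k T]
    [∀ m : ℤ, (shiftFunctor T m).Linear k]
    (n : ℕ) (hn : 3 ≤ n) (Tfd : ObjectProperty T) [Tfd.IsTriangulated] (M : T)
    (hCY : IsCYTriple k n Tfd (add M))
    (t : TStructure T) (ht : IsRightAdjacent (add M) t) (X Y : T) :
    -- (a) the direct system `T(X, Y) ⟶ T(X^{≤ 0}, Y) ⟶ T(X^{≤ -1}, Y) ⟶ ⋯` stabilizes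
    (∃ p : ℕ, (augHomSystem k t X Y).IsEventuallyConstantFrom p) ∧
    -- and `colim_p T(X^{≤ -p}, Y) ≅ T/Tfd(X, Y)`, via the quotient functor
    (∃ e : ↥(colimit (homSystem k t X Y)) ≃ₗ[k] (Tfd.trW.Q.obj X ⟶ Tfd.trW.Q.obj Y),
      ∀ (p : ℕ) (g : (t.truncLE (-(p : ℤ))).obj X ⟶ Y),
        Tfd.trW.Q.map ((t.truncLEι (-(p : ℤ))).app X) ≫
            e ((colimit.ι (homSystem k t X Y) p).hom g) = Tfd.trW.Q.map g) ∧
    -- (b) `T/Tfd(X, Y) ≅ lim_q colim_p T(Σ⁻¹ X^{≥ -p+1}, Y^{≤ -q})`, via the morphisms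
    -- `Σ⁻¹ X^{≥ -p+1} ⟶ X^{≤ -p}` of the truncation triangles
    (∃ e : ↥(limit (doubleSystem k t X Y)) ≃ₗ[k] (Tfd.trW.Q.obj X ⟶ Tfd.trW.Q.obj Y),
      ∀ (φ : Tfd.trW.Q.obj X ⟶ Tfd.trW.Q.obj Y) (p q : ℕ)
        (g : (t.truncLE (-(p : ℤ))).obj X ⟶ (t.truncLE (-(q : ℤ))).obj Y),
        Tfd.trW.Q.map ((t.truncLEι (-(p : ℤ))).app X) ≫ φ =
            Tfd.trW.Q.map (g ≫ (t.truncLEι (-(q : ℤ))).app Y) →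
        (limit.π (doubleSystem k t X Y) (op q)).hom (e.symm φ) =
          (colimit.ι ((connectingSystem k t X).obj ((towerLE t Y).obj (op q))) p).hom
            (connecting t X p ≫ g)) := by
  exact ⟨hCY.exists_isEventuallyConstantFrom ht X Y,
    hCY.exists_colimit_homSystem_linearEquiv ht X Y,
    hCY.exists_limit_doubleSystem_linearEquiv ht X Y⟩
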